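/- Let $W(E_8^{(1)})$ be the affine Weyl group of type $E_8^{(1)}$, that is, the group with generators $w_0,\dots,w_8$ and relations $w_i^2=1$ for all $i$, $(w_iw_{i+1})^3=1$ for $1\le i\le 6$, $(w_0w_7)^3=1$, $(w_3w_8)^3=1$, and $(w_iw_j)^2=1$ for all other pairs $i\neq j$. It acts from the left, by linear transformations, on the complex linear forms in nine parameters $u_1,\dots,u_8,b$, where the generators act as follows (parameters not mentioned are fixed): - $w_0$ exchanges $u_7$ and $u_8$; $w_8$ exchanges $u_1$ and $u_2$; $w_i$ exchanges $u_{i-1}$ and $u_i$ for $3\le i\le 7$; - $w_1(b)=-b$; - $w_2(u_j)=u_j-\tfrac34(2b+u_1+u_2)$ for $j=1,2$, $w_2(u_j)=u_j+\tfrac14(2b+u_1+u_2)$ for $3\le j\le 8$, and $w_2(b)=b-\tfrac14(2b+u_1+u_2)$. Let $\Omega$ be the set of all $\rho\in W(E_8^{(1)})$ such that $$\rho(u_1)=\rho(u_2),\quad \rho(u_3)=\rho(u_4),\quad \rho(u_5)=\rho(u_6),\quad \rho(u_7)=\rho(u_8)$$ hold at every point $(u_1,\dots,u_8,b)\in\mathbb{C}^9$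 with $u_1=u_2$, $u_3=u_4$, $u_5=u_6$, $u_7=u_8$. Then $\Omega$ is the subgroup $$\Omega=\langle w_0,w_1,w_2,r_1,w_4,r_2,w_6,r_3,w_8\rangle ,$$ where $r_1=w_3w_4w_8w_3$, $r_2=w_5w_4w_6w_5$ and $r_3=w_7w_6w_0w_7$. -/

import Mathlib

namespace E8Affine

/-- The Coxeter matrix of type `E₈⁽¹⁾`, with nodes `0, …, 8` and Dynkin diagram
`1 — 2 — 3 — 4 — 5 — 6 — 7 — 0`, the node `8` being attached to the node `3`. -/
def coxeterMatrix : CoxeterMatrix (Fin 9) where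
  M := !![1, 2, 2, 2, 2, 2, 2, 3, 2;
          2, 1, 3, 2, 2, 2, 2, 2, 2;
          2, 3, 1, 3, 2, 2, 2, 2, 2;
          2, 2, 3, 1, 3, 2, 2, 2, 3;
          2, 2, 2, 3, 1, 3, 2, 2, 2;
          2, 2, 2, 2, 3, 1, 3, 2, 2;
          2, 2, 2, 2, 2, 3, 1, 3, 2;
          3, 2, 2, 2, 2, 2, 3, 1, 2;
          2, 2, 2, 3, 2, 2, 2, 2, 1]
  isSymm := by
    ext i j
    fin_cases i <;> fin_cases j <;> rfl
  diagonal := by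
    intro i
    fin_cases i <;> rfl
  off_diagonal := by
    intro i j h
    fin_cases i <;> fin_cases j <;> first | exact absurd rfl h | exact of_decide_eq_true rfl

/-- The affine Weyl group `W(E₈⁽¹⁾)`: generators `w₀, …, w₈`, with relations `(wᵢ wⱼ) ^ mᵢⱼ = 1`. -/
abbrev WeylGroup : Type := coxeterMatrix.Group

/-- The generators `w₀, …, w₈` of `W(E₈⁽¹⁾)`. -/
def w (i : Fin 9) : WeylGroup := coxeterMatrix.simple i

/-- The names of the nine parameters. -/
inductive Param : Type
  | u1 | u2 | u3 | u4 | u5 | u6 | u7 | u8 | b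
  deriving DecidableEq

open Param in
instance : Fintype Param where
  elems := {u1, u2, u3, u4, u5, u6, u7, u8, b}
  complete q := by cases q <;> simp

/-- Complex linear forms in the nine parameters `u₁, …, u₈, b`, given by their coefficients. -/
abbrev LinForm : Type := Param → ℂ

/-- A parameter, regarded as a linear form. -/
def X (q : Param) : LinForm := Pi.single q 1

/-- The value of a linear form at a point `p` of the parameter space `ℂ⁹`. -/
def LinForm.eval (p : Param → ℂ) (f : LinForm) : ℂ := ∑ q, f q * p q

open Param in
/-- The image of each parameter under each generator `wᵢ`. -/
noncomputable def genImage : Fin 9 → Param → LinForm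
  | 0, q => X (Equiv.swap u7 u8 q)
  | 1, b => -X b
  | 1, q => X q
  | 2, u1 => X u1 - (3 / 4 : ℂ) • ((2 : ℂ) • X b + X u1 + X u2)
  | 2, u2 => X u2 - (3 / 4 : ℂ) • ((2 : ℂ) • X b + X u1 + X u2)
  | 2, b => X b - (1 / 4 : ℂ) • ((2 : ℂ) • X b + X u1 + X u2)
  | 2, q => X q + (1 / 4 : ℂ) • ((2 : ℂ) • X b + X u1 + X u2)
  | 3, q => X (Equiv.swap u2 u3 q)
  | 4, q => X (Equiv.swap u3 u4 q)
  | 5, q => X (Equiv.swap u4 u5 q)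
  | 6, q => X (Equiv.swap u5 u6 q)
  | 7, q => X (Equiv.swap u6 u7 q)
  | 8, q => X (Equiv.swap u1 u2 q)

/-- The action of the generator `wᵢ` on linear forms: the linear extension of `genImage i`. -/
noncomputable def genAction (i : Fin 9) : Module.End ℂ LinForm :=
  Fintype.linearCombination ℂ (genImage i)

section Relations

/-! Auxiliary facts: every generator acts as a reflection, and the Coxeter relations hold. -/

open Param in
/-- The linear form that `wᵢ` negates. -/
noncomputable def root : Fin 9 → LinForm
  | 0 => X u8 - X u7
  | 1 => (-4 : ℂ) • X b
  | 2 => (2 : ℂ) • X b + X u1 + X u2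
  | 3 => X u3 - X u2
  | 4 => X u4 - X u3
  | 5 => X u5 - X u4
  | 6 => X u6 - X u5
  | 7 => X u7 - X u6
  | 8 => X u2 - X u1

open Param in
/-- The coefficients of the coroots. -/
noncomputable def corootCoeff : Fin 9 → Param → ℂ
  | 0, u7 => -1
  | 0, u8 => 1
  | 1, b => -1 / 2
  | 2, u1 => 3 / 4
  | 2, u2 => 3 / 4
  | 2, b => 1 / 4
  | 2, _ => -1 / 4
  | 3, u2 => -1
  | 3, u3 => 1
  | 4, u3 => -1
  | 4, u4 => 1
  | 5, u4 => -1
  | 5, u5 => 1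
  | 6, u5 => -1
  | 6, u6 => 1
  | 7, u6 => -1
  | 7, u7 => 1
  | 8, u1 => -1
  | 8, u2 => 1
  | _, _ => 0

/-- The coroots, as linear functionals on linear forms. -/
noncomputable def coroot (i : Fin 9) : LinForm →ₗ[ℂ] ℂ :=
  Fintype.linearCombination ℂ (corootCoeff i)

theorem genImage_eq (i : Fin 9) (q : Param) :
    genImage i q = X q - corootCoeff i q • root i := by
  fin_cases i <;> cases q <;> simp [genImage, corootCoeff, root, Equiv.swap_apply_def] <;> module

theorem genAction_apply (i : Fin 9) (v : LinForm) :
    genAction i v = v - coroot i v • root i := by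
  have h : ∑ q, v q • X q = v := by
    ext q
    simp [X, Finset.sum_apply, Pi.single_apply]
  simp only [genAction, coroot, Fintype.linearCombination_apply, genImage_eq, smul_sub,
    Finset.sum_sub_distrib, h, Finset.sum_smul, smul_assoc]

theorem coroot_root (i j : Fin 9) :
    coroot i (root j) =
      if coxeterMatrix i j = 1 then 2 else if coxeterMatrix i j = 2 then 0 else -1 := by
  have h : ∀ k q, coroot k (X q) = corootCoeff k q := by
    intro k q
    simp [coroot, Fintype.linearCombination_apply, X, Pi.single_apply]
  fin_cases i <;> fin_cases j <;>
    simp [root, h, corootCoeff, coxeterMatrix, map_sub, map_add, map_smul] <;> norm_num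

theorem coxeterMatrix_cases (i j : Fin 9) :
    (i = j ∧ coxeterMatrix i j = 1) ∨
      (coxeterMatrix i j = 2 ∧ coxeterMatrix j i = 2) ∨
      (coxeterMatrix i j = 3 ∧ coxeterMatrix j i = 3) := by
  fin_cases i <;> fin_cases j <;> simp [coxeterMatrix]

theorem genAction_isLiftable : coxeterMatrix.IsLiftable genAction := by
  intro i j
  have hii : coroot i (root i) = 2 := by rw [coroot_root]; simp
  have hjj : coroot j (root j) = 2 := by rw [coroot_root]; simp
  have hij := coroot_root i j
  have hji := coroot_root j i
  apply LinearMap.ext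
  intro v
  rcases coxeterMatrix_cases i j with ⟨rfl, h⟩ | ⟨h, h'⟩ | ⟨h, h'⟩
  · rw [h]
    simp only [pow_one, Module.End.mul_apply, Module.End.one_apply, genAction_apply, map_sub,
      map_smul, hii]
    module
  · rw [h] at hij ⊢
    rw [h'] at hji
    norm_num at hij hji
    simp only [pow_succ, pow_zero, one_mul, Module.End.mul_apply, Module.End.one_apply,
      genAction_apply, map_sub, map_smul, hii, hjj, hij, hji]
    module
  · rw [h] at hij ⊢
    rw [h'] at hji
    norm_num at hij hji
    simp only [pow_succ, pow_zero, one_mul, Module.End.mul_apply, Module.End.one_apply,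
      genAction_apply, map_sub, map_smul, hii, hjj, hij, hji]
    module

end Relations

/-- The left action of `W(E₈⁽¹⁾)` on linear forms in the parameters `u₁, …, u₈, b`, for which
`(ρ σ)(f) = ρ (σ f)` and each `wᵢ` acts by `genImage i` on the parameters. -/
noncomputable def action : Representation ℂ WeylGroup LinForm :=
  coxeterMatrix.toCoxeterSystem.lift ⟨genAction, genAction_isLiftable⟩

/-- The action of a generator on a parameter is the prescribed one. -/
theorem action_w_X (i : Fin 9) (q : Param) : action (w i) (X q) = genImage i q := by
  have h : action (w i) = genAction i :=
    coxeterMatrix.toCoxeterSystem.lift_apply_simple genAction_isLiftable i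
  rw [h]
  simp [genAction, X, Fintype.linearCombination_apply_single]

open Param in
/-- The constraints `u₁ = u₂`, `u₃ = u₄`, `u₅ = u₆`, `u₇ = u₈` on a point of the parameter space. -/
def Constraint (p : Param → ℂ) : Prop :=
  p u1 = p u2 ∧ p u3 = p u4 ∧ p u5 = p u6 ∧ p u7 = p u8

/-- The set `Ω` of those `ρ ∈ W(E₈⁽¹⁾)` for which `ρ(u₁) = ρ(u₂)`, `ρ(u₃) = ρ(u₄)`,
`ρ(u₅) = ρ(u₆)`, `ρ(u₇) = ρ(u₈)` hold whenever the parameters satisfy the constraints. -/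
def Omega : Set WeylGroup :=
  {ρ | ∀ p : Param → ℂ, Constraint p →
    Constraint (fun q => LinForm.eval p (action ρ (X q)))}

/-- `r₁ = w₃ w₄ w₈ w₃`. -/
def r1 : WeylGroup := w 3 * w 4 * w 8 * w 3

/-- `r₂ = w₅ w₄ w₆ w₅`. -/
def r2 : WeylGroup := w 5 * w 4 * w 6 * w 5

/-- `r₃ = w₇ w₆ w₀ w₇`. -/
def r3 : WeylGroup := w 7 * w 6 * w 0 * w 7

end E8Affine

namespace E8Affine

open Param

/-! ### The action on roots -/

/-! The differences `u₂ - u₁`, `u₄ - u₃`, `u₆ - u₅`, `u₈ - u₇` are the simple roots of the mutually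
orthogonal nodes `J = {8, 4, 6, 0}`, so `Omega` is the set of `ρ` mapping the span of these roots
into itself (`mem_Omega`). Each proposed generator permutes these four roots up to sign, which gives
one inclusion.

The other inclusion is by induction on length. If some `w j` with `j ∈ J` shortens `ρ`, it is split
off. Otherwise each `ρ(αⱼ)` is positive, lies in the span and has square length 2, so it is a simple
root (`eq_root_of_mem_positiveCone`). If `ρ ≠ 1`, it has a descent `t` outside `J`. For `t = 1, 2`,
`w t` is itself a generator. For `t = 3, 5, 7`, the node `t` is joined to exactly two nodes `a`, `c`
of `J`, and `w t * w a * w c * w t`, one of the `rᵢ`, shortens `ρ` (`len_mul_conj_lt`). -/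

theorem sum_param {M : Type*} [AddCommMonoid M] (f : Param → M) :
    ∑ q, f q = f u1 + f u2 + f u3 + f u4 + f u5 + f u6 + f u7 + f u8 + f b := by
  have h : (Finset.univ : Finset Param) = {u1, u2, u3, u4, u5, u6, u7, u8, b} := rfl
  rw [h]
  simp [Finset.sum_insert, add_assoc]

theorem action_w (i : Fin 9) (v : LinForm) :
    action (w i) v = v - coroot i v • root i := by
  have h : action (w i) = genAction i :=
    coxeterMatrix.toCoxeterSystem.lift_apply_simple genAction_isLiftable i
  rw [h, genAction_apply]

theorem action_mul (ρ σ : WeylGroup) (v : LinForm) : action (ρ * σ) v = action ρ (action σ v) := by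
  rw [map_mul, Module.End.mul_apply]

theorem action_w_root_of_eq_two {i j : Fin 9} (h : coxeterMatrix i j = 2) :
    action (w i) (root j) = root j := by
  simp [action_w, coroot_root, h]

theorem action_w_root_of_eq_three {i j : Fin 9} (h : coxeterMatrix i j = 3) :
    action (w i) (root j) = root j + root i := by
  simp [action_w, coroot_root, h]

theorem action_w_root_self (i : Fin 9) : action (w i) (root i) = -root i := by
  rw [action_w, coroot_root, if_pos (by simp)]
  module

theorem action_injective (ρ : WeylGroup) : Function.Injective (action ρ) := by
  intro x y h
  have h' := congrArg (action ρ⁻¹) h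
  simpa [← action_mul] using h'

theorem w_mul_self (i : Fin 9) : w i * w i = 1 :=
  coxeterMatrix.toCoxeterSystem.simple_mul_simple_self i

theorem mul_w_mul_w (ρ : WeylGroup) (i : Fin 9) : ρ * w i * w i = ρ := by
  rw [mul_assoc, w_mul_self, mul_one]

theorem w_inv (i : Fin 9) : (w i)⁻¹ = w i := inv_eq_of_mul_eq_one_left (w_mul_self i)

theorem w_comm {i j : Fin 9} (h : coxeterMatrix i j = 2) : w i * w j = w j * w i := by
  have h' := coxeterMatrix.toCoxeterSystem.simple_mul_simple_pow i j
  rw [h] at h'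
  change (w i * w j) ^ 2 = 1 at h'
  rw [pow_two, mul_eq_one_iff_eq_inv] at h'
  rw [h', mul_inv_rev, w_inv, w_inv]

theorem w_braid {i j : Fin 9} (h : coxeterMatrix i j = 3) :
    w i * w j * w i = w j * w i * w j := by
  have h' := coxeterMatrix.toCoxeterSystem.simple_mul_simple_pow i j
  rw [h] at h'
  change (w i * w j) ^ 3 = 1 at h'
  have h'' : (w i * w j * w i) * (w j * w i * w j) = 1 := by
    rw [← h']; simp only [pow_succ, pow_zero, one_mul, mul_assoc]
  rw [mul_eq_one_iff_eq_inv] at h''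
  simp only [h'', mul_inv_rev, w_inv, mul_assoc]

/-! ### Length and positivity of roots -/

/-- The length function of the Coxeter group. -/
noncomputable def len (ρ : WeylGroup) : ℕ := coxeterMatrix.toCoxeterSystem.length ρ

theorem len_mul_w (ρ : WeylGroup) (i : Fin 9) :
    len (ρ * w i) = len ρ + 1 ∨ len (ρ * w i) + 1 = len ρ :=
  coxeterMatrix.toCoxeterSystem.length_mul_simple ρ i

theorem exists_len_mul_w_lt {ρ : WeylGroup} (h : ρ ≠ 1) : ∃ i, len (ρ * w i) < len ρ :=
  coxeterMatrix.toCoxeterSystem.exists_rightDescent_of_ne_one h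

/-- The additive monoid of sums of simple roots. -/
noncomputable def positiveCone : AddSubmonoid LinForm := AddSubmonoid.closure (Set.range root)

theorem root_mem_positiveCone (i : Fin 9) : root i ∈ positiveCone :=
  AddSubmonoid.subset_closure ⟨i, rfl⟩

theorem mem_positiveCone {v : LinForm} :
    v ∈ positiveCone ↔ ∃ c : Fin 9 → ℕ, v = ∑ i, (c i : ℂ) • root i := by
  rw [positiveCone, AddSubmonoid.mem_closure_range_iff_of_fintype]
  simp only [Nat.cast_smul_eq_nsmul]

/-- The link between length and signs of roots, by induction on length inside the rank-two subgroups
generated by `w i` and a right descent `w t`. All bonds here have order at most 3, so stripping at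
most two letters suffices. -/
theorem action_root_mem_positiveCone (ρ : WeylGroup) (i : Fin 9) (h : len ρ < len (ρ * w i)) :
    action ρ (root i) ∈ positiveCone := by
  induction hn : len ρ using Nat.strong_induction_on generalizing ρ i with
  | _ n ih =>
  subst hn
  by_cases h1 : ρ = 1
  · subst h1
    simpa using root_mem_positiveCone i
  obtain ⟨t, ht⟩ := exists_len_mul_w_lt h1
  obtain ⟨v, rfl⟩ : ∃ v, ρ = v * w t := ⟨ρ * w t, (mul_w_mul_w ρ t).symm⟩
  rw [mul_w_mul_w] at ht
  have hv := len_mul_w v t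
  rcases coxeterMatrix_cases i t with ⟨rfl, -⟩ | ⟨hit, hti⟩ | ⟨hit, hti⟩
  · rw [mul_w_mul_w] at h
    omega
  · rw [action_mul, action_w_root_of_eq_two hti]
    refine ih _ ht v i ?_ rfl
    rw [mul_assoc, w_comm hti, ← mul_assoc] at h
    have h1 := len_mul_w (v * w i) t
    have h2 := len_mul_w v i
    omega
  · rcases len_mul_w v i with hvi | hvi
    · rw [action_mul, action_w_root_of_eq_three hti, map_add]
      exact add_mem (ih _ ht v i (by omega) rfl) (ih _ ht v t ht rfl)
    · obtain ⟨x, rfl⟩ : ∃ x, v = x * w i := ⟨v * w i, (mul_w_mul_w v i).symm⟩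
      rw [mul_w_mul_w] at hvi
      have hx : action (x * w i * w t) (root i) = action x (root t) := by
        rw [action_mul, action_mul, action_w_root_of_eq_three hti, map_add, action_w_root_self,
          action_w_root_of_eq_three hit]
        congr 1
        abel
      rw [hx]
      refine ih _ (by omega) x t ?_ rfl
      -- The braid relation gives `x * w t * w i * w t` length `len x + 3`, which forces `w t` to
      -- lengthen `x`.
      have hb : x * w i * w t * w i = x * w t * w i * w t := by
        simpa only [mul_assoc] using congrArg (x * ·) (w_braid hit)
      rw [hb] at h
      have h1 := len_mul_w (x * w t * w i) t
      have h2 := len_mul_w (x * w t) i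
      have h3 := len_mul_w x t
      omega

theorem neg_action_root_mem_positiveCone (ρ : WeylGroup) (i : Fin 9)
    (h : len (ρ * w i) < len ρ) : -action ρ (root i) ∈ positiveCone := by
  have h1 := action_root_mem_positiveCone (ρ * w i) i (by rwa [mul_w_mul_w])
  rwa [action_mul, action_w_root_self, map_neg] at h1

theorem linearIndependent_root : LinearIndependent ℂ root := by
  rw [Fintype.linearIndependent_iff]
  intro g hg
  have e (q : Param) := congrFun hg q
  have e1 := e u1
  have e2 := e u2
  have e3 := e u3
  have e4 := e u4
  have e5 := e u5
  have e6 := e u6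
  have e7 := e u7
  have e8 := e u8
  have e9 := e b
  simp [Fin.sum_univ_succ, root, X] at e1 e2 e3 e4 e5 e6 e7 e8 e9
  have g7 : g 7 = 0 := by linear_combination e7 + e8
  have g6 : g 6 = 0 := by linear_combination e6 + g7
  have g5 : g 5 = 0 := by linear_combination e5 + g6
  have g4 : g 4 = 0 := by linear_combination e4 + g5
  have g3 : g 3 = 0 := by linear_combination e3 + g4
  have g2 : g 2 = 0 := by linear_combination (e1 + e2 + g3) / 2
  have g8 : g 8 = 0 := by linear_combination g2 - e1
  have g1 : g 1 = 0 := by linear_combination (2 * g2 - e9) / 4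
  intro i
  fin_cases i <;> assumption

theorem eq_of_sum_smul_root_eq {c d : Fin 9 → ℂ}
    (h : ∑ i, c i • root i = ∑ i, d i • root i) : c = d := by
  have h0 : ∑ i, (c i - d i) • root i = 0 := by
    simp only [sub_smul, Finset.sum_sub_distrib, h, sub_self]
  funext i
  exact sub_eq_zero.1 (Fintype.linearIndependent_iff.1 linearIndependent_root _ h0 i)

/-- If `-v` and `v + αₖ` are both positive, then `v` is a multiple of `αₖ`. -/
theorem exists_eq_smul_root {v : LinForm} {k : Fin 9} (h1 : -v ∈ positiveCone)
    (h2 : v + root k ∈ positiveCone) : ∃ n : ℕ, v = -(n : ℂ) • root k := by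
  obtain ⟨c, hc⟩ := mem_positiveCone.1 h1
  obtain ⟨d, hd⟩ := mem_positiveCone.1 h2
  -- The two expansions add up to `αₖ`; since the coefficients are natural numbers, both vanish away
  -- from `k`.
  have h : ∑ i, ((c i : ℂ) + d i) • root i = ∑ i, (Pi.single k (1 : ℂ) : Fin 9 → ℂ) i • root i := by
    simp only [add_smul, Finset.sum_add_distrib, ← hc, ← hd]
    simp [Pi.single_apply]
  have h' := eq_of_sum_smul_root_eq h
  refine ⟨c k, ?_⟩
  rw [eq_neg_of_add_eq_zero_left (neg_add_cancel v ▸ add_comm v (-v) : v + -v = 0), hc, neg_smul,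
    Finset.sum_eq_single k _ (by simp)]
  intro i _ hi
  have hi' := congrFun h' i
  rw [Pi.single_eq_of_ne hi] at hi'
  have : c i + d i = 0 := by exact_mod_cast hi'
  have : c i = 0 := by omega
  simp [this]

/-! ### The invariant form -/

/-- The invariant symmetric bilinear form, normalised so that roots have square length `2`. -/
noncomputable def form (v v' : LinForm) : ℂ :=
  v u1 * v' u1 + v u2 * v' u2 + v u3 * v' u3 + v u4 * v' u4 + v u5 * v' u5 + v u6 * v' u6 +
    v u7 * v' u7 + v u8 * v' u8 -
    (1 / 8) * (v u1 + v u2 + v u3 + v u4 + v u5 + v u6 + v u7 + v u8) *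
      (v' u1 + v' u2 + v' u3 + v' u4 + v' u5 + v' u6 + v' u7 + v' u8) +
    (1 / 8) * v b * v' b

/-- This makes each `w i` the orthogonal reflection in `αᵢ`, whence the invariance in `form_action`.
-/
theorem form_root_left (i : Fin 9) (v : LinForm) : form (root i) v = coroot i v := by
  rw [coroot, Fintype.linearCombination_apply, sum_param]
  fin_cases i <;> simp [form, root, X, corootCoeff] <;> ring

theorem form_sub_smul_self (v v' : LinForm) (c : ℂ) :
    form (v - c • v') (v - c • v') = form v v - 2 * c * form v' v + c ^ 2 * form v' v' := by
  simp only [form, Pi.sub_apply, Pi.smul_apply, smul_eq_mul]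
  ring

theorem form_action (ρ : WeylGroup) (v : LinForm) : form (action ρ v) (action ρ v) = form v v := by
  induction ρ using coxeterMatrix.toCoxeterSystem.simple_induction_left with
  | one => simp
  | mul_simple_left ρ i ih =>
    rw [← ih]
    change form (action (w i * ρ) v) (action (w i * ρ) v) = _
    rw [action_mul, action_w, form_sub_smul_self, form_root_left, form_root_left, coroot_root,
      if_pos (by simp)]
    ring

theorem form_root_self (i : Fin 9) : form (root i) (root i) = 2 := by
  rw [form_root_left, coroot_root, if_pos (by simp)]

/-! ### The stabiliser of the constraints -/

/-- The simple roots that vanish under the constraints. -/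
def nodes : Finset (Fin 9) := {0, 4, 6, 8}

/-- The linear forms that vanish under the constraints. -/
noncomputable def constraintForms : Submodule ℂ LinForm := Submodule.span ℂ (root '' nodes)

theorem root_mem_constraintForms {j : Fin 9} (h : j ∈ nodes) : root j ∈ constraintForms :=
  Submodule.subset_span ⟨j, h, rfl⟩

theorem mem_constraintForms {f : LinForm} : f ∈ constraintForms ↔
    f u1 + f u2 = 0 ∧ f u3 + f u4 = 0 ∧ f u5 + f u6 = 0 ∧ f u7 + f u8 = 0 ∧ f b = 0 := by
  constructor
  · intro h
    induction h using Submodule.span_induction with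
    | mem x hx =>
      obtain ⟨j, hj, rfl⟩ := hx
      simp only [nodes, Finset.coe_insert, Finset.coe_singleton, Set.mem_insert_iff,
        Set.mem_singleton_iff] at hj
      rcases hj with rfl | rfl | rfl | rfl <;> simp [root, X]
    | zero => simp
    | add x y _ _ hx hy =>
      obtain ⟨h1, h2, h3, h4, h5⟩ := hx
      obtain ⟨k1, k2, k3, k4, k5⟩ := hy
      simp only [Pi.add_apply]
      refine ⟨?_, ?_, ?_, ?_, ?_⟩
      · linear_combination h1 + k1
      · linear_combination h2 + k2
      · linear_combination h3 + k3
      · linear_combination h4 + k4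
      · linear_combination h5 + k5
    | smul a x _ hx =>
      obtain ⟨h1, h2, h3, h4, h5⟩ := hx
      simp only [Pi.smul_apply, ← smul_add, h1, h2, h3, h4, h5, smul_zero, and_self]
  · rintro ⟨h1, h2, h3, h4, h5⟩
    have h : f = f u2 • root 8 + f u4 • root 4 + f u6 • root 6 + f u8 • root 0 := by
      funext q
      have k1 := eq_neg_of_add_eq_zero_left h1
      have k2 := eq_neg_of_add_eq_zero_left h2
      have k3 := eq_neg_of_add_eq_zero_left h3
      have k4 := eq_neg_of_add_eq_zero_left h4
      cases q <;> simp [root, X, k1, k2, k3, k4, h5]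
    rw [h]
    refine add_mem (add_mem (add_mem ?_ ?_) ?_) ?_ <;>
      exact Submodule.smul_mem _ _ (root_mem_constraintForms (by decide))

theorem mem_constraintForms_iff_eval {f : LinForm} :
    f ∈ constraintForms ↔ ∀ p, Constraint p → LinForm.eval p f = 0 := by
  rw [mem_constraintForms]
  simp only [LinForm.eval, sum_param, Constraint]
  constructor
  · rintro ⟨h1, h2, h3, h4, h5⟩ p ⟨e1, e2, e3, e4⟩
    rw [e1, e2, e3, e4]
    linear_combination p u2 * h1 + p u4 * h2 + p u6 * h3 + p u8 * h4 + p b * h5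
  · intro h
    -- Here `X` serves as a point of the parameter space; the five test points span the constrained
    -- subspace.
    have k1 := h (X u1 + X u2) (by simp [X])
    have k2 := h (X u3 + X u4) (by simp [X])
    have k3 := h (X u5 + X u6) (by simp [X])
    have k4 := h (X u7 + X u8) (by simp [X])
    have k5 := h (X b) (by simp [X])
    simp [X] at k1 k2 k3 k4 k5
    exact ⟨k1, k2, k3, k4, k5⟩

theorem eval_sub (p : Param → ℂ) (f g : LinForm) :
    LinForm.eval p (f - g) = LinForm.eval p f - LinForm.eval p g := by
  simp [LinForm.eval, sub_mul]

theorem mem_Omega {ρ : WeylGroup} :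
    ρ ∈ Omega ↔ ∀ j ∈ nodes, action ρ (root j) ∈ constraintForms := by
  simp only [mem_constraintForms_iff_eval, nodes, Finset.mem_insert, Finset.mem_singleton,
    forall_eq_or_imp, forall_eq, root, map_sub, eval_sub, sub_eq_zero, Omega, Set.mem_ofPred_eq]
  simp only [Constraint]
  constructor
  · intro h
    exact ⟨fun p hp => (h p hp).2.2.2.symm, fun p hp => (h p hp).2.1.symm,
      fun p hp => (h p hp).2.2.1.symm, fun p hp => (h p hp).1.symm⟩
  · rintro ⟨h1, h2, h3, h4⟩ p hp
    exact ⟨(h4 p hp).symm, (h2 p hp).symm, (h3 p hp).symm, (h1 p hp).symm⟩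

theorem action_mem_constraintForms {ρ : WeylGroup} (hρ : ρ ∈ Omega) {f : LinForm}
    (hf : f ∈ constraintForms) : action ρ f ∈ constraintForms := by
  have h : constraintForms ≤ constraintForms.comap (action ρ) := by
    refine Submodule.span_le.2 ?_
    rintro _ ⟨j, hj, rfl⟩
    exact mem_Omega.1 hρ j hj
  exact h hf

theorem one_mem_Omega : (1 : WeylGroup) ∈ Omega :=
  mem_Omega.2 fun j hj => by simpa using root_mem_constraintForms hj

theorem mul_mem_Omega {ρ σ : WeylGroup} (hρ : ρ ∈ Omega) (hσ : σ ∈ Omega) : ρ * σ ∈ Omega :=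
  mem_Omega.2 fun j hj => by
    rw [action_mul]
    exact action_mem_constraintForms hρ (mem_Omega.1 hσ j hj)

/-- On the span of four orthogonal roots the form is `2 ∑ cⱼ²`; with natural coefficients, the value
2 leaves a single coefficient, equal to 1. -/
theorem eq_root_of_mem_positiveCone {f : LinForm} (h : f ∈ positiveCone)
    (hf : f ∈ constraintForms) (h2 : form f f = 2) : ∃ k ∈ nodes, f = root k := by
  obtain ⟨c, hc⟩ := mem_positiveCone.1 h
  obtain ⟨h1, h3, h5, h7, hb⟩ := mem_constraintForms.1 hf
  have e (q : Param) := congrFun hc q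
  have e1 := e u1
  have e2 := e u2
  have e3 := e u3
  have e4 := e u4
  have e5 := e u5
  have e6 := e u6
  have e7 := e u7
  have e8 := e u8
  have e9 := e b
  simp [Fin.sum_univ_succ, root, X] at e1 e2 e3 e4 e5 e6 e7 e8 e9
  -- The pair sums and the `b`-coefficient of `f`, all zero, equal `c₇`, `c₅ - c₇`, `c₃ - c₅`, `2c₂
  -- - c₃` and `2c₂ - 4c₁`; they eliminate the nodes outside `nodes` one by one.
  have c7 : c 7 = 0 := by
    have : (c 7 : ℂ) = 0 := by linear_combination h7 - e7 - e8
    exact_mod_cast this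
  have c5 : c 5 = 0 := by
    have : (c 5 : ℂ) = c 7 := by linear_combination h5 - e5 - e6
    rw [← c7]
    exact_mod_cast this
  have c3 : c 3 = 0 := by
    have : (c 3 : ℂ) = c 5 := by linear_combination h3 - e3 - e4
    rw [← c5]
    exact_mod_cast this
  have c2 : c 2 = 0 := by
    have : 2 * (c 2 : ℂ) = c 3 := by linear_combination h1 - e1 - e2
    have : 2 * c 2 = c 3 := by exact_mod_cast this
    omega
  have c1 : c 1 = 0 := by
    have : 4 * (c 1 : ℂ) = 2 * c 2 := by linear_combination e9 - hb
    have : 4 * c 1 = 2 * c 2 := by exact_mod_cast this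
    omega
  have hs : c 8 ^ 2 + c 4 ^ 2 + c 6 ^ 2 + c 0 ^ 2 = 1 := by
    have : (c 8 : ℂ) ^ 2 + (c 4 : ℂ) ^ 2 + (c 6 : ℂ) ^ 2 + (c 0 : ℂ) ^ 2 = 1 := by
      simp only [form, e1, e2, e3, e4, e5, e6, e7, e8, e9, c1, c2, c3, c5, c7,
        Nat.cast_zero] at h2
      linear_combination h2 / 2
    exact_mod_cast this
  have hle (i : Fin 9) (hi : c i ^ 2 ≤ 1) : c i = 0 ∨ c i = 1 := by
    have : c i < 2 := by nlinarith
    omega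
  have hf' : f = (c 8 : ℂ) • root 8 + (c 4 : ℂ) • root 4 + (c 6 : ℂ) • root 6 +
      (c 0 : ℂ) • root 0 := by
    rw [hc]
    simp [Fin.sum_univ_succ, c1, c2, c3, c5, c7]
    abel
  rcases hle 8 (by omega) with k8 | k8 <;> rcases hle 4 (by omega) with k4 | k4 <;>
    rcases hle 6 (by omega) with k6 | k6 <;> rcases hle 0 (by omega) with k0 | k0 <;>
    simp only [k8, k4, k6, k0] at hs hf' <;> norm_num at hs
  · exact ⟨0, by decide, by simpa using hf'⟩
  · exact ⟨6, by decide, by simpa using hf'⟩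
  · exact ⟨4, by decide, by simpa using hf'⟩
  · exact ⟨8, by decide, by simpa using hf'⟩

/-! ### The generators -/

/-- The proposed generators of `Omega`. -/
def generators : Set WeylGroup := {w 0, w 1, w 2, r1, w 4, r2, w 6, r3, w 8}

theorem w_mem_Omega {i : Fin 9} (h : ∀ j ∈ nodes, coxeterMatrix i j ≠ 3) : w i ∈ Omega := by
  refine mem_Omega.2 fun j hj => ?_
  have hj' := root_mem_constraintForms hj
  rcases coxeterMatrix_cases i j with ⟨rfl, -⟩ | ⟨hij, -⟩ | ⟨hij, -⟩
  · rw [action_w_root_self]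
    exact neg_mem hj'
  · rwa [action_w_root_of_eq_two hij]
  · exact absurd hij (h j hj)

/-- The element `w t * w a * w c * w t`, where `t` is joined to the orthogonal nodes `a` and `c`,
maps the simple root of `a` to that of `c`. -/
theorem action_conj_root {t a c : Fin 9} (ha : coxeterMatrix t a = 3) (hc : coxeterMatrix t c = 3)
    (hac : coxeterMatrix a c = 2) :
    action (w t * w a * w c * w t) (root a) = root c := by
  have ha' : coxeterMatrix a t = 3 := by rw [coxeterMatrix.symmetric, ha]
  have hc' : coxeterMatrix c t = 3 := by rw [coxeterMatrix.symmetric, hc]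
  have hac' : coxeterMatrix c a = 2 := by rw [coxeterMatrix.symmetric, hac]
  simp only [action_mul, action_w_root_of_eq_three, action_w_root_of_eq_two, action_w_root_self,
    map_add, map_neg, ha, hc, hac, ha', hc', hac']
  abel

/-- Since `w a` and `w c` commute, the element is symmetric in `a` and `c`, so it exchanges their
roots; it fixes the other roots of `nodes`, which are orthogonal to all three nodes. -/
theorem conj_mem_Omega {t a c : Fin 9} (ha : coxeterMatrix t a = 3) (hc : coxeterMatrix t c = 3)
    (hac : coxeterMatrix a c = 2) (han : a ∈ nodes) (hcn : c ∈ nodes)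
    (h : ∀ j ∈ nodes, j = a ∨ j = c ∨
      coxeterMatrix t j = 2 ∧ coxeterMatrix a j = 2 ∧ coxeterMatrix c j = 2) :
    w t * w a * w c * w t ∈ Omega := by
  refine mem_Omega.2 fun j hj => ?_
  rcases h j hj with rfl | rfl | ⟨h1, h2, h3⟩
  · rw [action_conj_root ha hc hac]
    exact root_mem_constraintForms hcn
  · have hca : coxeterMatrix j a = 2 := by rw [coxeterMatrix.symmetric, hac]
    have he : w t * w a * w j * w t = w t * w j * w a * w t := by
      rw [mul_assoc (w t), w_comm hac, ← mul_assoc]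
    rw [he, action_conj_root hc ha hca]
    exact root_mem_constraintForms han
  · simp only [action_mul, action_w_root_of_eq_two, h1, h2, h3]
    exact root_mem_constraintForms hj

theorem r1_mem_Omega : r1 ∈ Omega :=
  conj_mem_Omega rfl rfl rfl (by decide) (by decide) (by decide)

theorem r2_mem_Omega : r2 ∈ Omega :=
  conj_mem_Omega rfl rfl rfl (by decide) (by decide) (by decide)

theorem r3_mem_Omega : r3 ∈ Omega :=
  conj_mem_Omega rfl rfl rfl (by decide) (by decide) (by decide)

theorem generators_subset_Omega : generators ⊆ Omega := by
  intro g hg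
  simp only [generators, Set.mem_insert_iff, Set.mem_singleton_iff] at hg
  rcases hg with rfl | rfl | rfl | rfl | rfl | rfl | rfl | rfl | rfl
  · exact w_mem_Omega (by decide)
  · exact w_mem_Omega (by decide)
  · exact w_mem_Omega (by decide)
  · exact r1_mem_Omega
  · exact w_mem_Omega (by decide)
  · exact r2_mem_Omega
  · exact w_mem_Omega (by decide)
  · exact r3_mem_Omega
  · exact w_mem_Omega (by decide)

theorem conj_inv {t a c : Fin 9} (hac : coxeterMatrix a c = 2) :
    (w t * w a * w c * w t)⁻¹ = w t * w a * w c * w t := by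
  simp only [mul_inv_rev, w_inv]
  rw [mul_assoc (w t) (w a), w_comm hac]
  simp only [mul_assoc]

theorem inv_of_mem_generators {g : WeylGroup} (hg : g ∈ generators) : g⁻¹ = g := by
  simp only [generators, Set.mem_insert_iff, Set.mem_singleton_iff] at hg
  rcases hg with rfl | rfl | rfl | rfl | rfl | rfl | rfl | rfl | rfl
  all_goals first | exact w_inv _ | exact conj_inv rfl

/-- As the generators are involutions, closure of `Omega` under products suffices; closure under
inverses need not be known beforehand. -/
theorem closure_subset_Omega : (Subgroup.closure generators : Set WeylGroup) ⊆ Omega := by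
  intro g hg
  induction hg using Subgroup.closure_induction'' with
  | mem x hx => exact generators_subset_Omega hx
  | inv_mem x hx => exact (inv_of_mem_generators hx).symm ▸ generators_subset_Omega hx
  | one => exact one_mem_Omega
  | mul x y _ _ hx hy => exact mul_mem_Omega hx hy

/-- If `ρ` maps the simple root of `a` to a simple root and `t ≠ a` is a descent of `ρ`, then
`ρ(αₜ + αₐ)` is not positive. -/
theorem action_root_add_root_notMem {ρ : WeylGroup} {t a k : Fin 9} (hta : t ≠ a)
    (ht : len (ρ * w t) < len ρ) (ha : action ρ (root a) = root k) :
    action ρ (root t + root a) ∉ positiveCone := by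
  intro h
  rw [map_add, ha] at h
  -- This yields `ρ(αₜ) = -n αₖ = ρ(-n αₐ)`, so `αₜ = -n αₐ`, against linear independence.
  obtain ⟨n, hn⟩ := exists_eq_smul_root (neg_action_root_mem_positiveCone ρ t ht) h
  rw [← ha, ← map_smul] at hn
  have h1 := action_injective ρ hn
  have h2 : ∑ i, (Pi.single t (1 : ℂ) : Fin 9 → ℂ) i • root i =
      ∑ i, (Pi.single a (-(n : ℂ)) : Fin 9 → ℂ) i • root i := by
    simpa [Pi.single_apply] using h1
  have h3 := congrFun (eq_of_sum_smul_root_eq h2) t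
  simp [hta] at h3

/-- The first three letters each lower the length, because `ρ(αₜ + αₐ)` and `ρ(αₜ + α_c)` are not
positive; the last letter can restore at most one. -/
theorem len_mul_conj_lt {ρ : WeylGroup} {t a c k l : Fin 9} (hta : coxeterMatrix t a = 3)
    (htc : coxeterMatrix t c = 3) (hac : coxeterMatrix a c = 2)
    (hρa : action ρ (root a) = root k) (hρc : action ρ (root c) = root l)
    (ht : len (ρ * w t) < len ρ) : len (ρ * (w t * w a * w c * w t)) < len ρ := by
  have hne {x : Fin 9} (hx : coxeterMatrix t x = 3) : t ≠ x := by
    rintro rfl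
    simp at hx
  have h1 : len (ρ * w t * w a) + 1 = len (ρ * w t) := by
    refine (len_mul_w _ _).resolve_left fun h => ?_
    have h' := action_root_mem_positiveCone (ρ * w t) a (by omega)
    rw [action_mul, action_w_root_of_eq_three hta, add_comm] at h'
    exact action_root_add_root_notMem (hne hta) ht hρa h'
  have h2 : len (ρ * w t * w a * w c) + 1 = len (ρ * w t * w a) := by
    refine (len_mul_w _ _).resolve_left fun h => ?_
    have h' := action_root_mem_positiveCone (ρ * w t * w a) c (by omega)
    rw [action_mul, action_w_root_of_eq_two hac, action_mul, action_w_root_of_eq_three htc,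
      add_comm] at h'
    exact action_root_add_root_notMem (hne htc) ht hρc h'
  have h3 := len_mul_w (ρ * w t * w a * w c) t
  simp only [← mul_assoc]
  omega

theorem Omega_subset_closure : Omega ⊆ (Subgroup.closure generators : Set WeylGroup) := by
  intro ρ hρ
  induction hn : len ρ using Nat.strong_induction_on generalizing ρ with
  | _ n ih =>
  subst hn
  have step {g : WeylGroup} (hg : g ∈ generators) (hlt : len (ρ * g) < len ρ) :
      ρ ∈ (Subgroup.closure generators : Set WeylGroup) :=
    (Subgroup.mul_mem_cancel_right _ (Subgroup.subset_closure hg)).1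
      (ih _ hlt (mul_mem_Omega hρ (generators_subset_Omega hg)) rfl)
  by_cases hJ : ∃ j ∈ nodes, len (ρ * w j) < len ρ
  · obtain ⟨j, hj, hlt⟩ := hJ
    refine step ?_ hlt
    simp only [nodes, Finset.mem_insert, Finset.mem_singleton] at hj
    rcases hj with rfl | rfl | rfl | rfl <;> simp [generators]
  push Not at hJ
  -- With no descent in `nodes`, `ρ` maps each of the four roots to a positive element of
  -- `constraintForms` of square length 2.
  have hroot (j : Fin 9) (hj : j ∈ nodes) : ∃ k, action ρ (root j) = root k := by
    have hlen : len ρ < len (ρ * w j) := by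
      have h1 := hJ j hj
      have h2 := len_mul_w ρ j
      omega
    obtain ⟨k, -, hk⟩ := eq_root_of_mem_positiveCone (action_root_mem_positiveCone ρ j hlen)
      (mem_Omega.1 hρ j hj) (by rw [form_action, form_root_self])
    exact ⟨k, hk⟩
  by_cases h1 : ρ = 1
  · subst h1
    exact one_mem _
  obtain ⟨t, ht⟩ := exists_len_mul_w_lt h1
  have htn : t ∉ nodes := fun h => absurd ht (not_lt.2 (hJ t h))
  obtain ⟨k0, hk0⟩ := hroot 0 (by decide)
  obtain ⟨k4, hk4⟩ := hroot 4 (by decide)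
  obtain ⟨k6, hk6⟩ := hroot 6 (by decide)
  obtain ⟨k8, hk8⟩ := hroot 8 (by decide)
  have ht' : t = 1 ∨ t = 2 ∨ t = 3 ∨ t = 5 ∨ t = 7 := by
    revert htn; clear * -; revert t; decide
  rcases ht' with rfl | rfl | rfl | rfl | rfl
  · exact step (by simp [generators]) ht
  · exact step (by simp [generators]) ht
  · exact step (g := r1) (by simp [generators]) (len_mul_conj_lt rfl rfl rfl hk4 hk8 ht)
  · exact step (g := r2) (by simp [generators]) (len_mul_conj_lt rfl rfl rfl hk4 hk6 ht)
  · exact step (g := r3) (by simp [generators]) (len_mul_conj_lt rfl rfl rfl hk6 hk0 ht)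

end E8Affine

open E8Affine in
theorem mainTheorem2 :
    Omega = (Subgroup.closure {w 0, w 1, w 2, r1, w 4, r2, w 6, r3, w 8} : Set WeylGroup) :=
  Set.Subset.antisymm Omega_subset_closure closure_subset_Omega
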